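/- Let $(R,\mathfrak m)$ be a complete Noetherian local ring, let $E=E(R/\mathfrak m)$ be an injective hull of the $R$-module $R/\mathfrak m$, and let $A$ be an Artinian $R$-module of dimension at most one, i.e. $\dim R/\mathrm{Ann}_R A\le 1$ (the zero module is allowed). Let $N=\mathrm{Hom}_R(A,E)$ be the Matlis dual of $A$. Define $$r(A)=\sup\{\ell\big((B:_A\mathfrak m)/B\big)\mid B\subseteq A \text{ an } R\text{-submodule}\},\qquad B:_A\mathfrak m=\{a\in A\mid \mathfrak m a\subseteq B\},$$ where $\ell$ denotes length, and $$c(N)=\sup\{v(L)\mid L\subseteq N \text{ an } R\text{-submodule}\},$$ where $v(L)$ is the minimal number of generators of $L$; both suprema are taken in $\mathbb N\cup\{\infty\}$. Then $r(A)=c(N)$. -/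

import Mathlib

universe u v w

/-- `ι : M → E` exhibits `E` as an injective hull of `M`: `E` is injective, `ι` is a monomorphism,
and `E` is an essential extension of the image of `M`.  (Smallness of `R` ensures that injectivity
tested on modules in the universe of `E` is injectivity in the absolute sense.) -/
structure IsInjectiveHull (R : Type u) [CommRing R] [Small.{w} R]
    (M : Type v) [AddCommGroup M] [Module R M] (E : Type w) [AddCommGroup E] [Module R E]
    (ι : M →ₗ[R] E) : Prop where
  injective_module : Module.Injective R E
  injective_map : Function.Injective ι
  essential : ∀ U : Submodule R E, U ⊓ LinearMap.range ι = ⊥ → U = ⊥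

/-- Injective hulls exist. -/
theorem exists_isInjectiveHull (R : Type u) [CommRing R] [Small.{w} R]
    (M : Type w) [AddCommGroup M] [Module R M] :
    ∃ (E : Type w) (_ : AddCommGroup E) (_ : Module R E) (ι : M →ₗ[R] E),
      IsInjectiveHull R M E ι := by
  obtain ⟨⟨Q, hQ, f, hf⟩⟩ :=
    (inferInstance : CategoryTheory.EnoughInjectives (ModuleCat.{w} R)).presentation
      (ModuleCat.of R M)
  have hQ' : Module.Injective R Q := Module.injective_module_of_injective_object R Q
  have hf' : Function.Injective f.hom := (ModuleCat.mono_iff_injective f).1 hf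
  set K : Submodule R Q := LinearMap.range f.hom with hK
  let S : Set (Submodule R Q) := {F | K ≤ F ∧ ∀ U ≤ F, U ⊓ K = ⊥ → U = ⊥}
  obtain ⟨F, -, hF⟩ := zorn_le_nonempty₀ S (fun c hc hchain y hy => by
    refine ⟨sSup c, ⟨(hc hy).1.trans (le_sSup hy), fun U hU hUK => ?_⟩, fun z hz => le_sSup hz⟩
    rw [eq_bot_iff]
    intro x hx
    obtain ⟨G, hG, hxG⟩ := (Submodule.mem_sSup_of_directed ⟨y, hy⟩ hchain.directedOn).1 (hU hx)
    have h1 : Submodule.span R {x} = ⊥ := (hc hG).2 _ (by simpa using hxG) (by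
      rw [eq_bot_iff, ← hUK]
      exact inf_le_inf_right _ (by simpa using hx))
    simpa using h1) K ⟨le_rfl, fun U hU h => by rwa [inf_eq_left.2 hU] at h⟩
  let T : Set (Submodule R Q) := {C | C ⊓ F = ⊥}
  obtain ⟨C, -, hC⟩ := zorn_le_nonempty₀ T (fun c hc hchain y hy => by
    refine ⟨sSup c, ?_, fun z hz => le_sSup hz⟩
    change sSup c ⊓ F = ⊥
    rw [eq_bot_iff]
    rintro x ⟨hx, hxF⟩
    obtain ⟨G, hG, hxG⟩ := (Submodule.mem_sSup_of_directed ⟨y, hy⟩ hchain.directedOn).1 hx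
    have : x ∈ G ⊓ F := ⟨hxG, hxF⟩
    rwa [show G ⊓ F = ⊥ from hc hG] at this) ⊥ (by simp [T])
  have hCF : C ⊓ F = ⊥ := hC.prop
  have hinj : Function.Injective (C.mkQ ∘ₗ F.subtype) := by
    rw [← LinearMap.ker_eq_bot, eq_bot_iff]
    rintro ⟨x, hx⟩ hxk
    have hxC : x ∈ C := by simpa using hxk
    have : x ∈ C ⊓ F := ⟨hxC, hx⟩
    rw [hCF] at this
    simpa using this
  obtain ⟨h, hh⟩ := hQ'.out _ hinj F.subtype
  let p : Q →ₗ[R] Q := h ∘ₗ C.mkQ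
  have hp : ∀ x ∈ F, p x = x := fun x hx => hh ⟨x, hx⟩
  have hpC : ∀ x ∈ C, p x = 0 := fun x hx => by
    have : C.mkQ x = 0 := by simpa using hx
    simp only [p, LinearMap.comp_apply, this, map_zero]
  have key : ∀ U : Submodule R Q, U ⊓ F = ⊥ → U.comap p ≤ C := fun U hU => by
    refine hC.le_of_ge (y := U.comap p) ?_ ?_
    · change _ ⊓ F = ⊥
      rw [eq_bot_iff]
      rintro x ⟨hx, hxF⟩
      have hx' : p x ∈ U := hx
      rw [hp x hxF] at hx'
      rw [← hU]
      exact ⟨hx', hxF⟩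
    · intro x hx
      change p x ∈ U
      rw [hpC x hx]
      exact U.zero_mem
  have hrange : LinearMap.range p ≤ F := by
    refine hF.le_of_ge (y := LinearMap.range p) ⟨?_, fun U hU hUK => ?_⟩ ?_
    · exact fun x hx => ⟨x, hp x (hF.prop.1 hx)⟩
    · have h1 : U ⊓ F = ⊥ := hF.prop.2 _ inf_le_right (by
        rw [eq_bot_iff, ← hUK]
        exact inf_le_inf_right _ inf_le_left)
      rw [eq_bot_iff]
      intro x hx
      obtain ⟨y, rfl⟩ := hU hx
      simpa using hpC y (key U h1 hx)
    · exact fun x hx => ⟨x, hp x hx⟩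
  let q : Q →ₗ[R] F := p.codRestrict F (fun x => hrange ⟨x, rfl⟩)
  refine ⟨F, inferInstance, inferInstance,
    f.hom.codRestrict F (fun x => hF.prop.1 ⟨x, rfl⟩), ⟨fun X Y _ _ _ _ i hi g => ?_⟩, ?_, ?_⟩
  · obtain ⟨k, hk⟩ := hQ'.out i hi (F.subtype ∘ₗ g)
    refine ⟨q ∘ₗ k, fun x => Subtype.ext ?_⟩
    change p (k (i x)) = g x
    rw [hk]
    exact hp _ (g x).2
  · intro x y hxy
    exact hf' (congrArg Subtype.val hxy)
  · intro U hU
    have h1 : U.map F.subtype = ⊥ := hF.prop.2 _ (Submodule.map_subtype_le F U) (by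
      rw [eq_bot_iff]
      rintro _ ⟨⟨x, hx, rfl⟩, m, hm⟩
      have : x ∈ U ⊓ LinearMap.range
          (f.hom.codRestrict F (fun x => hF.prop.1 ⟨x, rfl⟩)) :=
        ⟨hx, m, Subtype.ext hm⟩
      rw [hU] at this
      simpa using this)
    exact Submodule.map_injective_of_injective F.injective_subtype (by simpa using h1)

/-- For a submodule `B` of `A` and an ideal `I`, the submodule
`B :_A I = {a ∈ A | I a ⊆ B}` of `A`. -/
def residualSubmodule {R : Type u} [CommRing R] {A : Type v} [AddCommGroup A] [Module R A]
    (B : Submodule R A) (I : Ideal R) : Submodule R A where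
  carrier := {a | ∀ r ∈ I, r • a ∈ B}
  zero_mem' := fun r _ => by simp
  add_mem' := fun ha hb r hr => by
    rw [smul_add]
    exact B.add_mem (ha r hr) (hb r hr)
  smul_mem' := fun c a ha r hr => by
    rw [smul_comm]
    exact B.smul_mem c (ha r hr)

/-- The length of the `R`-module `(B :_A 𝔪) / B`, where `𝔪` is the maximal ideal of `R`. -/
noncomputable def residualLength (R : Type u) [CommRing R] [IsLocalRing R]
    {A : Type v} [AddCommGroup A] [Module R A] (B : Submodule R A) : ℕ∞ :=
  Module.length R (↥(residualSubmodule B (IsLocalRing.maximalIdeal R)) ⧸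
    B.submoduleOf (residualSubmodule B (IsLocalRing.maximalIdeal R)))

/-- `r(A) = sup {ℓ((B :_A 𝔪) / B) | B ⊆ A}`, with values in `ℕ ∪ {∞}`. -/
noncomputable def rInvariant (R : Type u) [CommRing R] [IsLocalRing R]
    (A : Type v) [AddCommGroup A] [Module R A] : ℕ∞ :=
  ⨆ B : Submodule R A, residualLength R B

/-- The minimal number of generators `v(L)` of a submodule `L`, with values in `ℕ ∪ {∞}`. -/
noncomputable def minGenerators {R : Type u} [CommRing R]
    {N : Type v} [AddCommGroup N] [Module R N] (L : Submodule R N) : ℕ∞ :=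
  ⨅ (s : Set N) (_ : Submodule.span R s = L), s.encard

/-- `c(N) = sup {v(L) | L ⊆ N}`, with values in `ℕ ∪ {∞}`. -/
noncomputable def cInvariant (R : Type u) [CommRing R]
    (N : Type v) [AddCommGroup N] [Module R N] : ℕ∞ :=
  ⨆ L : Submodule R N, minGenerators L

/-! Taking common zeros is an order-reversing bijection from submodules of `N` to submodules of `A`.
If `L` goes to `B`, then `𝔪L` goes to `B :_A 𝔪`, so the interval `[𝔪L, L]` is anti-isomorphic to
`[B, B :_A 𝔪]`. Since `N` is then Noetherian, Nakayama gives `v(L) = ℓ(L/𝔪L) = ℓ((B :_A 𝔪)/B)`: the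
two suprema agree term by term. For the bijection, `B` is recovered because `E` cogenerates
(`Module.Baer.exists_apply_ne_zero`). A finitely generated `L` is recovered because, by
completeness, endomorphisms of `E` act on `𝔪`-power torsion as scalars
(`exists_forall_smul_eq_of_pow_smul_eq_zero`); the Artinian condition reduces any `L` to that case.
-/

/-- Submodules between `B` and `C` correspond to submodules of `C / B`. -/
def Submodule.subquotientOrderIso {R : Type*} [Ring R] {A : Type*} [AddCommGroup A] [Module R A]
    (B C : Submodule R A) (h : B ≤ C) : Submodule R (C ⧸ B.submoduleOf C) ≃o Set.Icc B C :=
  (Submodule.comapMkQRelIso _).trans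
    { toFun := fun p => ⟨p.1.map C.subtype, by
        constructor
        · intro x hx
          exact ⟨⟨x, h hx⟩, p.2 (by simpa [Submodule.submoduleOf] using hx), rfl⟩
        · exact Submodule.map_subtype_le _ _⟩
      invFun := fun q => ⟨q.1.comap C.subtype, Submodule.comap_mono q.2.1⟩
      left_inv := fun p => Subtype.ext
        (Submodule.comap_map_eq_of_injective C.subtype_injective p.1)
      right_inv := fun q => Subtype.ext (by simp [Submodule.map_comap_subtype, q.2.2])
      map_rel_iff' := by
        intro p q
        exact Submodule.map_le_map_iff_of_injective C.subtype_injective p.1 q.1 }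

/-- This makes length an invariant of the interval as an ordered set, so an anti-isomorphism of
intervals suffices to compare lengths. -/
theorem Module.length_subquotient {R : Type*} [Ring R] {A : Type*} [AddCommGroup A] [Module R A]
    (B C : Submodule R A) (h : B ≤ C) :
    (Module.length R (C ⧸ B.submoduleOf C) : WithBot ℕ∞) = Order.krullDim (Set.Icc B C) := by
  rw [Module.coe_length, Order.krullDim_eq_of_orderIso (Submodule.subquotientOrderIso B C h)]

theorem minGenerators_eq_length {R : Type*} [CommRing R] [IsLocalRing R] {N : Type*}
    [AddCommGroup N] [Module R N] (L : Submodule R N) (hL : L.FG) :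
    minGenerators L =
      Module.length R (L ⧸ (IsLocalRing.maximalIdeal R • L).submoduleOf L) := by
  have h1 : minGenerators L = L.spanFinrank := by
    rw [minGenerators, ← Submodule.spanRank_toENat_eq_iInf_encard, hL.spanRank_eq_spanFinrank]
    simp
  have h2 : (IsLocalRing.maximalIdeal R • L).submoduleOf L =
      IsLocalRing.maximalIdeal R • (⊤ : Submodule R L) := by
    apply Submodule.map_injective_of_injective L.subtype_injective
    rw [Submodule.map_smul'', Submodule.map_top, Submodule.range_subtype, Submodule.submoduleOf,
      Submodule.map_comap_subtype, inf_eq_right]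
    exact Submodule.smul_le_right
  rw [h1, h2, IsLocalRing.spanFinrank_eq_finrank_quotient L hL]
  have : Module.Finite R L := Module.Finite.iff_fg.2 hL
  let : Field (R ⧸ IsLocalRing.maximalIdeal R) := Ideal.Quotient.field _
  have : Module.Finite (R ⧸ IsLocalRing.maximalIdeal R)
      (L ⧸ IsLocalRing.maximalIdeal R • (⊤ : Submodule R L)) :=
    Module.Finite.of_restrictScalars_finite R _ _
  rw [Module.length_eq_of_surjective (R := R ⧸ IsLocalRing.maximalIdeal R) (S := R)
    Ideal.Quotient.mk_surjective, Module.length_eq_finrank]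

/-! ### Annihilators and the cogenerator property -/

section MatlisDuality

open IsLocalRing

/-- The functionals `A → E` vanishing on the submodule `B`. -/
def Submodule.homAnnihilator {R : Type*} [CommRing R] {A : Type*} [AddCommGroup A] [Module R A]
    (E : Type*) [AddCommGroup E] [Module R E] (B : Submodule R A) : Submodule R (A →ₗ[R] E) where
  carrier := {f | ∀ a ∈ B, f a = 0}
  zero_mem' := fun _ _ => rfl
  add_mem' := fun hf hg a ha => by simp [hf a ha, hg a ha]
  smul_mem' := fun c f hf a ha => by simp [hf a ha]

/-- The common zeros of a submodule of functionals `A → E`. -/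
def Submodule.homCoannihilator {R : Type*} [CommRing R] {A : Type*} [AddCommGroup A] [Module R A]
    {E : Type*} [AddCommGroup E] [Module R E] (L : Submodule R (A →ₗ[R] E)) :
    Submodule R A where
  carrier := {a | ∀ f ∈ L, f a = 0}
  zero_mem' := fun f _ => map_zero f
  add_mem' := fun ha hb f hf => by simp [ha f hf, hb f hf]
  smul_mem' := fun c a ha f hf => by simp [ha f hf]

theorem Submodule.homCoannihilator_smul {R : Type*} [CommRing R] {A : Type*} [AddCommGroup A]
    [Module R A] {E : Type*} [AddCommGroup E] [Module R E] (L : Submodule R (A →ₗ[R] E))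
    (I : Ideal R) : (I • L).homCoannihilator = residualSubmodule L.homCoannihilator I := by
  ext a
  constructor
  · intro h r hr f hf
    simpa using h (r • f) (Submodule.smul_mem_smul hr hf)
  · intro h f hf
    induction hf using Submodule.smul_induction_on' with
    | smul r hr f hf => simpa using h r hr f hf
    | add f _ g _ hf hg => simp [hf, hg]

theorem Submodule.homCoannihilator_antitone {R : Type*} [CommRing R] {A : Type*} [AddCommGroup A]
    [Module R A] {E : Type*} [AddCommGroup E] [Module R E] :
    Antitone (Submodule.homCoannihilator (R := R) (A := A) (E := E)) :=
  fun _ _ h _ ha f hf => ha f (h hf)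

theorem Submodule.homAnnihilator_antitone {R : Type*} [CommRing R] {A : Type*} [AddCommGroup A]
    [Module R A] {E : Type*} [AddCommGroup E] [Module R E] :
    Antitone (Submodule.homAnnihilator (R := R) (A := A) E) :=
  fun _ _ h _ hf a ha => hf a (h ha)

variable {R : Type u} [CommRing R] [IsLocalRing R] {E : Type w} [AddCommGroup E] [Module R E]

/-- The annihilator of `x ≠ 0` contains no unit, so `Rx` maps onto the residue field, hence
nontrivially to `E`; injectivity extends the map to `M`. -/
theorem Module.Baer.exists_apply_ne_zero (hb : Module.Baer R E) (ι : ResidueField R →ₗ[R] E)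
    (hι : Function.Injective ι) {M : Type*} [AddCommGroup M] [Module R M] {x : M} (hx : x ≠ 0) :
    ∃ f : M →ₗ[R] E, f x ≠ 0 := by
  have hker : LinearMap.ker (LinearMap.toSpanSingleton R M x) ≤
      LinearMap.ker (Algebra.linearMap R (ResidueField R)) := by
    intro r hr
    have h1 : r • x = 0 := by simpa using hr
    have h2 : r ∈ maximalIdeal R := by
      intro hu
      exact hx ((hu.smul_eq_zero).1 h1)
    simpa using h2
  obtain ⟨h, hh⟩ := hb.extension_property
    ((LinearMap.ker (LinearMap.toSpanSingleton R M x)).liftQ (LinearMap.toSpanSingleton R M x)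
      le_rfl)
    (LinearMap.ker_eq_bot.1 (Submodule.ker_liftQ_eq_bot _ _ _ le_rfl))
    (ι ∘ₗ (LinearMap.ker (LinearMap.toSpanSingleton R M x)).liftQ
      (Algebra.linearMap R (ResidueField R)) hker)
  refine ⟨h, fun h0 => ?_⟩
  have h1 := LinearMap.congr_fun hh (Submodule.Quotient.mk 1)
  simp only [LinearMap.comp_apply, Submodule.liftQ_apply, LinearMap.toSpanSingleton_apply,
    one_smul, Algebra.linearMap_apply, map_one] at h1
  rw [h0] at h1
  exact one_ne_zero (hι (by rw [← h1, map_zero]))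

theorem Submodule.homCoannihilator_homAnnihilator (hb : Module.Baer R E)
    (ι : ResidueField R →ₗ[R] E) (hι : Function.Injective ι) {A : Type*} [AddCommGroup A]
    [Module R A] (B : Submodule R A) : (B.homAnnihilator E).homCoannihilator = B := by
  refine le_antisymm (fun a ha => ?_) (fun a ha f hf => hf a ha)
  by_contra haB
  obtain ⟨f, hf⟩ := hb.exists_apply_ne_zero ι hι (x := B.mkQ a) (by simpa using haB)
  refine hf (ha (f ∘ₗ B.mkQ) fun b hb => ?_)
  have : B.mkQ b = 0 := by simpa using hb
  rw [LinearMap.comp_apply, this, map_zero]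

/-- By essentiality some nonzero `r • y` lies in the range; `r` must be a unit, as `𝔪` kills `y`. -/
theorem mem_range_of_maximalIdeal_smul_eq_zero (ι : ResidueField R →ₗ[R] E)
    (hess : ∀ U : Submodule R E, U ⊓ LinearMap.range ι = ⊥ → U = ⊥) {y : E}
    (hy : ∀ r ∈ maximalIdeal R, r • y = 0) : y ∈ LinearMap.range ι := by
  by_cases hy0 : y = 0
  · rw [hy0]; exact zero_mem _
  have h1 : Submodule.span R {y} ⊓ LinearMap.range ι ≠ ⊥ := fun h => by
    simpa [hy0] using hess _ h
  obtain ⟨z, ⟨hz, hzι⟩, hz0⟩ := Submodule.exists_mem_ne_zero_of_ne_bot h1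
  obtain ⟨r, rfl⟩ := Submodule.mem_span_singleton.1 hz
  have hr : IsUnit r := by
    by_contra hr
    exact hz0 (hy r hr)
  obtain ⟨u, rfl⟩ := hr
  have := Submodule.smul_mem _ (↑u⁻¹ : R) hzι
  simpa [smul_smul] using this

/-! ### Duals of modules of finite length -/

theorem length_hom_le_one (ι : ResidueField R →ₗ[R] E)
    (hess : ∀ U : Submodule R E, U ⊓ LinearMap.range ι = ⊥ → U = ⊥)
    (S : Type*) [AddCommGroup S] [Module R S] [IsSimpleModule R S] :
    Module.length R (S →ₗ[R] E) ≤ 1 := by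
  obtain ⟨I, hI, ⟨e⟩⟩ := isSimpleModule_iff_quot_maximal.1 (inferInstance : IsSimpleModule R S)
  have hIm : I = maximalIdeal R := eq_maximalIdeal hI
  set x : S := e.symm (Submodule.Quotient.mk 1) with hxdef
  have hspan : ∀ s : S, ∃ r : R, s = r • x := by
    intro s
    obtain ⟨r, hr⟩ := Submodule.Quotient.mk_surjective _ (e s)
    refine ⟨r, e.injective ?_⟩
    rw [map_smul, hxdef, e.apply_symm_apply, ← hr, ← Submodule.Quotient.mk_smul, smul_eq_mul,
      mul_one]
  have hx : ∀ r ∈ maximalIdeal R, r • x = 0 := by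
    intro r hr
    rw [hxdef, ← map_smul, ← Submodule.Quotient.mk_smul, smul_eq_mul, mul_one,
      (Submodule.Quotient.mk_eq_zero _).2 (hIm ▸ hr), map_zero]
  let φ : (S →ₗ[R] E) →ₗ[R] LinearMap.range ι :=
    (LinearMap.applyₗ x).codRestrict (LinearMap.range ι) fun u =>
      mem_range_of_maximalIdeal_smul_eq_zero ι hess fun r hr => by
        change r • u x = 0
        rw [← map_smul, hx r hr, map_zero]
  have hφ : Function.Injective φ := by
    rw [← LinearMap.ker_eq_bot, eq_bot_iff]
    intro u hu
    have hux : u x = 0 := congrArg Subtype.val hu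
    refine LinearMap.ext fun s => ?_
    obtain ⟨r, rfl⟩ := hspan s
    simp [hux]
  have hk : Module.length R (ResidueField R) = 1 := by
    rw [Module.length_eq_of_surjective (R := ResidueField R) (S := R) residue_surjective]
    exact Module.length_eq_one _ _
  calc _ ≤ Module.length R (LinearMap.range ι) := Module.length_le_of_injective φ hφ
    _ ≤ Module.length R (ResidueField R) :=
        Module.length_le_of_surjective ι.rangeRestrict ι.surjective_rangeRestrict
    _ = 1 := hk

/-- Induction on a composition series; an upper bound needs only left exactness of `Hom(-, E)`. -/
theorem length_hom_le (ι : ResidueField R →ₗ[R] E)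
    (hess : ∀ U : Submodule R E, U ⊓ LinearMap.range ι = ⊥ → U = ⊥)
    {M : Type*} [AddCommGroup M] [Module R M] (hM : IsFiniteLength R M) :
    Module.length R (M →ₗ[R] E) ≤ Module.length R M := by
  induction hM with
  | of_subsingleton =>
    rw [Module.length_eq_zero, Module.length_eq_zero]
  | @of_simple_quotient M _ _ N _ hN ih =>
    let res : (M →ₗ[R] E) →ₗ[R] (N →ₗ[R] E) := LinearMap.lcomp R E N.subtype
    let ex : LinearMap.ker res →ₗ[R] ((M ⧸ N) →ₗ[R] E) :=
      { toFun := fun u => N.liftQ u.1 fun x hx => LinearMap.congr_fun u.2 (⟨x, hx⟩ : N)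
        map_add' := fun u v => by ext; rfl
        map_smul' := fun c u => by ext; rfl }
    have hex : Function.Injective ex := fun u v huv => Subtype.ext <| LinearMap.ext fun x =>
      LinearMap.congr_fun huv (N.mkQ x)
    have h1 : Module.length R (M →ₗ[R] E) =
        Module.length R (LinearMap.ker res) + Module.length R (LinearMap.range res) :=
      Module.length_eq_add_of_exact (LinearMap.ker res).subtype res.rangeRestrict
        (Submodule.subtype_injective _) res.surjective_rangeRestrict (fun x => by
          simp [Subtype.ext_iff])
    have h2 : Module.length R M = Module.length R N + Module.length R (M ⧸ N) :=
      Module.length_eq_add_of_exact N.subtype N.mkQ N.subtype_injective N.mkQ_surjective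
        (LinearMap.exact_subtype_mkQ N)
    rw [h1, h2, add_comm, Module.length_eq_one R (M ⧸ N)]
    exact add_le_add ((Module.length_le_of_injective (LinearMap.range res).subtype
      (Submodule.subtype_injective _)).trans ih)
      ((Module.length_le_of_injective ex hex).trans (length_hom_le_one ι hess _))

/-- Biduality for modules of finite length. -/
theorem exists_eq_apply_of_isFiniteLength (hb : Module.Baer R E) (ι : ResidueField R →ₗ[R] E)
    (hι : Function.Injective ι)
    (hess : ∀ U : Submodule R E, U ⊓ LinearMap.range ι = ⊥ → U = ⊥)
    {M : Type*} [AddCommGroup M] [Module R M] (hM : IsFiniteLength R M)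
    (φ : (M →ₗ[R] E) →ₗ[R] E) : ∃ x : M, ∀ u : M →ₗ[R] E, φ u = u x := by
  let ev : M →ₗ[R] ((M →ₗ[R] E) →ₗ[R] E) := LinearMap.applyₗ
  have hev : Function.Injective ev := by
    rw [← LinearMap.ker_eq_bot, eq_bot_iff]
    intro x hx
    by_contra hx0
    obtain ⟨f, hf⟩ := hb.exists_apply_ne_zero ι hι hx0
    exact hf (LinearMap.congr_fun hx f)
  have h1 := length_hom_le ι hess hM
  have hD : IsFiniteLength R (M →ₗ[R] E) :=
    Module.length_ne_top_iff.1 (ne_top_of_le_ne_top (Module.length_ne_top_iff.2 hM) h1)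
  have h2 := (length_hom_le ι hess hD).trans h1
  have hDD : IsFiniteLength R ((M →ₗ[R] E) →ₗ[R] E) :=
    Module.length_ne_top_iff.1 (ne_top_of_le_ne_top (Module.length_ne_top_iff.2 hM) h2)
  obtain ⟨_, _⟩ := isFiniteLength_iff_isNoetherian_isArtinian.1 hDD
  -- A proper submodule of the bidual would be strictly shorter than `M`, yet `M` embeds in the
  -- range.
  have hr : LinearMap.range ev = ⊤ := by
    by_contra hne
    refine (Submodule.length_lt hne).not_ge (h2.trans ?_)
    exact Module.length_le_of_injective ev.rangeRestrict
      (by simpa [LinearMap.rangeRestrict] using hev)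
  obtain ⟨x, hx⟩ := LinearMap.range_eq_top.1 hr φ
  exact ⟨x, fun u => (LinearMap.congr_fun hx u).symm⟩

/-! ### Endomorphisms of `E` over a complete ring -/

theorem isFiniteLength_quotient_maximalIdeal_pow [IsNoetherianRing R] (n : ℕ) :
    IsFiniteLength R (R ⧸ maximalIdeal R ^ n) := by
  -- For `n = 0` the quotient is zero, hence not local.
  rcases subsingleton_or_nontrivial (R ⧸ maximalIdeal R ^ n) with h | h
  · exact .of_subsingleton
  have : IsLocalRing (R ⧸ maximalIdeal R ^ n) :=
    .of_surjective' (Ideal.Quotient.mk _) Ideal.Quotient.mk_surjective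
  have hart : IsArtinianRing (R ⧸ maximalIdeal R ^ n) := by
    rw [isArtinianRing_iff_isNilpotent_maximalIdeal]
    refine ⟨n, ?_⟩
    rw [← map_maximalIdeal_of_surjective (Ideal.Quotient.mk (maximalIdeal R ^ n))
      Ideal.Quotient.mk_surjective, ← Ideal.map_pow, Ideal.map_quotient_self]
    rfl
  rw [← Module.length_ne_top_iff, Module.length_eq_of_surjective
    (R := R ⧸ maximalIdeal R ^ n) (S := R) Ideal.Quotient.mk_surjective]
  exact Module.length_ne_top

/-- The `𝔪^n`-torsion of `E` is `Hom(R/𝔪^n, E)`, so `g` induces a functional on this dual; biduality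
makes it evaluation at the class of some `r`. -/
theorem exists_smul_eq_of_pow_smul_eq_zero [IsNoetherianRing R] (hb : Module.Baer R E)
    (ι : ResidueField R →ₗ[R] E) (hι : Function.Injective ι)
    (hess : ∀ U : Submodule R E, U ⊓ LinearMap.range ι = ⊥ → U = ⊥) (g : E →ₗ[R] E) (n : ℕ) :
    ∃ r : R, ∀ x : E, (∀ s ∈ maximalIdeal R ^ n, s • x = 0) → g x = r • x := by
  obtain ⟨y, hy⟩ := exists_eq_apply_of_isFiniteLength hb ι hι hess
    (isFiniteLength_quotient_maximalIdeal_pow (R := R) n)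
    (g ∘ₗ LinearMap.applyₗ (Submodule.Quotient.mk 1))
  obtain ⟨r, rfl⟩ := Submodule.Quotient.mk_surjective _ y
  refine ⟨r, fun x hx => ?_⟩
  have h1 := hy ((maximalIdeal R ^ n).liftQ (LinearMap.toSpanSingleton R E x) fun s hs => by
    simpa using hx s hs)
  simpa only [LinearMap.comp_apply, LinearMap.applyₗ_apply_apply, Submodule.liftQ_apply,
    LinearMap.toSpanSingleton_apply, one_smul] using h1

theorem mem_pow_of_smul_eq_zero (hb : Module.Baer R E)
    (ι : ResidueField R →ₗ[R] E) (hι : Function.Injective ι) (n : ℕ) (r : R)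
    (hr : ∀ x : E, (∀ s ∈ maximalIdeal R ^ n, s • x = 0) → r • x = 0) :
    r ∈ maximalIdeal R ^ n := by
  by_contra h
  obtain ⟨f, hf⟩ := hb.exists_apply_ne_zero ι hι (M := R ⧸ maximalIdeal R ^ n)
    (x := Submodule.Quotient.mk r) (by rwa [ne_eq, Submodule.Quotient.mk_eq_zero])
  have hmk : ∀ s : R, (Submodule.Quotient.mk s : R ⧸ maximalIdeal R ^ n) =
      s • Submodule.Quotient.mk 1 := fun s => by
    rw [← Submodule.Quotient.mk_smul, smul_eq_mul, mul_one]
  refine hf ?_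
  rw [hmk, map_smul]
  refine hr _ fun s hs => ?_
  rw [← map_smul, ← hmk, (Submodule.Quotient.mk_eq_zero _).2 hs, map_zero]

/-- Over a complete local ring, endomorphisms of `E` act on the `𝔪`-power torsion as scalars. -/
theorem exists_forall_smul_eq_of_pow_smul_eq_zero [IsNoetherianRing R]
    [IsAdicComplete (maximalIdeal R) R] (hb : Module.Baer R E)
    (ι : ResidueField R →ₗ[R] E) (hι : Function.Injective ι)
    (hess : ∀ U : Submodule R E, U ⊓ LinearMap.range ι = ⊥ → U = ⊥) (g : E →ₗ[R] E) :
    ∃ r : R, ∀ (n : ℕ) (x : E), (∀ s ∈ maximalIdeal R ^ n, s • x = 0) → g x = r • x := by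
  choose r hr using exists_smul_eq_of_pow_smul_eq_zero hb ι hι hess g
  -- `r m` and `r n` act alike on `𝔪^m`-torsion, so they are congruent modulo `𝔪^m`; `l` is the
  -- limit.
  obtain ⟨l, hl⟩ := IsPrecomplete.prec' (I := maximalIdeal R) r (fun {m n} hmn => by
    rw [SModEq.sub_mem, smul_eq_mul, Ideal.mul_top]
    refine mem_pow_of_smul_eq_zero hb ι hι m _ fun x hx => ?_
    rw [sub_smul, ← hr m x hx, ← hr n x fun s hs => hx s (Ideal.pow_le_pow_right hmn hs), sub_self])
  refine ⟨l, fun n x hx => ?_⟩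
  have h1 := hl n
  rw [SModEq.sub_mem, smul_eq_mul, Ideal.mul_top] at h1
  rw [hr n x hx, ← sub_eq_zero, ← sub_smul, hx _ h1]

/-! ### Double annihilators and comparison of lengths -/

theorem exists_pow_smul_eq_zero [IsNoetherianRing R] {A : Type*} [AddCommGroup A] [Module R A]
    [IsArtinian R A] (a : A) : ∃ n : ℕ, ∀ s ∈ maximalIdeal R ^ n, s • a = 0 := by
  let c : ℕ →o (Submodule R A)ᵒᵈ :=
    { toFun := fun n => OrderDual.toDual (maximalIdeal R ^ n • Submodule.span R {a})
      monotone' := fun i j h => Submodule.smul_mono_left (Ideal.pow_le_pow_right h) }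
  obtain ⟨n, hn⟩ := IsArtinian.monotone_stabilizes c
  have hn' : maximalIdeal R ^ n • Submodule.span R {a} =
    maximalIdeal R ^ (n + 1) • Submodule.span R {a} := hn (n + 1) n.le_succ
  have hbot : maximalIdeal R ^ n • Submodule.span R {a} = ⊥ := by
    apply Submodule.eq_bot_of_le_smul_of_le_jacobson_bot (maximalIdeal R)
    · exact Submodule.FG.smul (IsNoetherian.noetherian _) (Submodule.fg_span_singleton a)
    · rw [← Submodule.mul_smul, ← pow_succ', ← hn']
    · rw [jacobson_eq_maximalIdeal _ bot_ne_top]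
  refine ⟨n, fun s hs => ?_⟩
  have := Submodule.smul_mem_smul hs (Submodule.mem_span_singleton_self (R := R) a)
  rwa [hbot, Submodule.mem_bot] at this

/-- Generators of `L` give `Φ : A → E^n` whose kernel is killed by `f`, so `f = h ∘ Φ` with `h : E^n
→ E` by injectivity. The components of `h` act as scalars on the torsion elements `F i a`. -/
theorem Submodule.FG.mem_of_homCoannihilator [IsNoetherianRing R]
    [IsAdicComplete (maximalIdeal R) R] (hb : Module.Baer R E)
    (ι : ResidueField R →ₗ[R] E) (hι : Function.Injective ι)
    (hess : ∀ U : Submodule R E, U ⊓ LinearMap.range ι = ⊥ → U = ⊥)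
    {A : Type*} [AddCommGroup A] [Module R A] [IsArtinian R A]
    {L : Submodule R (A →ₗ[R] E)} (hL : L.FG) {f : A →ₗ[R] E}
    (hf : ∀ a ∈ L.homCoannihilator, f a = 0) : f ∈ L := by
  obtain ⟨n, F, hF⟩ := Submodule.fg_iff_exists_fin_generating_family.1 hL
  have hFL : ∀ i, F i ∈ L := fun i => hF ▸ Submodule.subset_span ⟨i, rfl⟩
  let Φ : A →ₗ[R] (Fin n → E) := LinearMap.pi F
  have hker : LinearMap.ker Φ ≤ LinearMap.ker f := by
    intro a ha
    refine hf a fun u hu => ?_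
    rw [← hF] at hu
    induction hu using Submodule.span_induction with
    | mem u hu => obtain ⟨i, rfl⟩ := hu; exact congrFun ha i
    | zero => rfl
    | add u v _ _ hu hv => simp [hu, hv]
    | smul c u _ hu => simp [hu]
  obtain ⟨h, hh⟩ := hb.extension_property ((LinearMap.ker Φ).liftQ Φ le_rfl)
    (LinearMap.ker_eq_bot.1 (Submodule.ker_liftQ_eq_bot _ _ _ le_rfl))
    ((LinearMap.ker Φ).liftQ f hker)
  have hfa : ∀ a, f a = h (Φ a) := fun a => (LinearMap.congr_fun hh (Submodule.Quotient.mk a)).symm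
  choose r hr using fun i => exists_forall_smul_eq_of_pow_smul_eq_zero hb ι hι hess
    (h ∘ₗ LinearMap.single R (fun _ : Fin n => E) i)
  have : f = ∑ i, r i • F i := by
    ext a
    obtain ⟨m, hm⟩ := exists_pow_smul_eq_zero (R := R) a
    rw [hfa, LinearMap.sum_apply, ← Finset.univ_sum_single (Φ a), map_sum]
    refine Finset.sum_congr rfl fun i _ => ?_
    exact hr i m (F i a) fun s hs => by rw [← map_smul, hm s hs, map_zero]
  rw [this]
  exact Submodule.sum_mem _ fun i _ => Submodule.smul_mem _ _ (hFL i)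

theorem Submodule.homAnnihilator_homCoannihilator [IsNoetherianRing R]
    [IsAdicComplete (maximalIdeal R) R] (hb : Module.Baer R E)
    (ι : ResidueField R →ₗ[R] E) (hι : Function.Injective ι)
    (hess : ∀ U : Submodule R E, U ⊓ LinearMap.range ι = ⊥ → U = ⊥)
    {A : Type*} [AddCommGroup A] [Module R A] [IsArtinian R A]
    (L : Submodule R (A →ₗ[R] E)) : L.homCoannihilator.homAnnihilator E = L := by
  refine le_antisymm (fun f hf => ?_) (fun f hf a ha => ha f hf)
  -- `L₀` has minimal common zeros among finitely generated submodules of `L`, so adjoining any `u ∈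
  -- L` removes no zero.
  obtain ⟨_, ⟨L₀, ⟨hL₀, hfg⟩, rfl⟩, hmin⟩ := set_has_minimal_iff_artinian.2 ‹IsArtinian R A›
    (Submodule.homCoannihilator '' {L₀ : Submodule R (A →ₗ[R] E) | L₀ ≤ L ∧ L₀.FG})
    ⟨_, ⊥, ⟨bot_le, Submodule.fg_bot⟩, rfl⟩
  refine hL₀ (hfg.mem_of_homCoannihilator hb ι hι hess fun a ha => hf a fun u hu => ?_)
  have h1 : (L₀ ⊔ Submodule.span R {u}).homCoannihilator = L₀.homCoannihilator := by
    by_contra hne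
    exact hmin _ ⟨L₀ ⊔ Submodule.span R {u}, ⟨sup_le hL₀ (by simpa using hu),
      hfg.sup (Submodule.fg_span_singleton u)⟩, rfl⟩
      (lt_of_le_of_ne (Submodule.homCoannihilator_antitone le_sup_left) hne)
  rw [← h1] at ha
  exact ha u (Submodule.mem_sup_right (Submodule.mem_span_singleton_self u))

/-- Matlis duality between submodules of an Artinian module and those of its dual. -/
def Submodule.homAnnihilatorOrderIso [IsNoetherianRing R]
    [IsAdicComplete (maximalIdeal R) R] (hb : Module.Baer R E)
    (ι : ResidueField R →ₗ[R] E) (hι : Function.Injective ι)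
    (hess : ∀ U : Submodule R E, U ⊓ LinearMap.range ι = ⊥ → U = ⊥)
    (A : Type*) [AddCommGroup A] [Module R A] [IsArtinian R A] :
    Submodule R (A →ₗ[R] E) ≃o (Submodule R A)ᵒᵈ where
  toFun L := OrderDual.toDual L.homCoannihilator
  invFun B := (OrderDual.ofDual B).homAnnihilator E
  left_inv L := Submodule.homAnnihilator_homCoannihilator hb ι hι hess L
  right_inv B := Submodule.homCoannihilator_homAnnihilator hb ι hι (OrderDual.ofDual B)
  map_rel_iff' {L L'} := by
    refine ⟨fun h => ?_, fun h => Submodule.homCoannihilator_antitone h⟩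
    rw [← Submodule.homAnnihilator_homCoannihilator hb ι hι hess L,
      ← Submodule.homAnnihilator_homCoannihilator hb ι hι hess L']
    exact Submodule.homAnnihilator_antitone h

theorem minGenerators_eq_residualLength [IsNoetherianRing R]
    [IsAdicComplete (maximalIdeal R) R] (hb : Module.Baer R E)
    (ι : ResidueField R →ₗ[R] E) (hι : Function.Injective ι)
    (hess : ∀ U : Submodule R E, U ⊓ LinearMap.range ι = ⊥ → U = ⊥)
    {A : Type*} [AddCommGroup A] [Module R A] [IsArtinian R A]
    (L : Submodule R (A →ₗ[R] E)) : minGenerators L = residualLength R L.homCoannihilator := by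
  let e := Submodule.homAnnihilatorOrderIso hb ι hι hess A
  -- The descending chain condition on `A` becomes the ascending one on its dual.
  have hN : IsNoetherian R (A →ₗ[R] E) := by
    rw [isNoetherian_iff]
    exact (e.toOrderEmbedding.dual.wellFounded (wellFounded_lt (α := Submodule R A)))
  let e' : Set.Icc (maximalIdeal R • L) L ≃o
      (Set.Icc L.homCoannihilator (maximalIdeal R • L).homCoannihilator)ᵒᵈ :=
    { toFun := fun x => OrderDual.toDual ⟨x.1.homCoannihilator,
        Submodule.homCoannihilator_antitone x.2.2, Submodule.homCoannihilator_antitone x.2.1⟩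
      invFun := fun y => ⟨e.symm (OrderDual.toDual (OrderDual.ofDual y).1),
        e.le_symm_apply.2 (OrderDual.ofDual y).2.2, e.symm_apply_le.2 (OrderDual.ofDual y).2.1⟩
      left_inv := fun x => Subtype.ext (e.symm_apply_apply x.1)
      right_inv := fun y => Subtype.ext (e.apply_symm_apply (OrderDual.toDual (OrderDual.ofDual y).1))
      map_rel_iff' := fun {x y} => e.le_iff_le (x := x.1) (y := y.1) }
  rw [minGenerators_eq_length L (IsNoetherian.noetherian L), residualLength]
  apply WithBot.coe_injective
  rw [← Submodule.homCoannihilator_smul, Module.length_subquotient _ _ Submodule.smul_le_right,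
    Module.length_subquotient _ _ (Submodule.homCoannihilator_antitone Submodule.smul_le_right),
    Order.krullDim_eq_of_orderIso e', Order.krullDim_orderDual]

end MatlisDuality

theorem mainTheorem4
    {R : Type u} [CommRing R] [IsLocalRing R] [IsNoetherianRing R]
    [IsAdicComplete (IsLocalRing.maximalIdeal R) R]
    {E : Type w} [AddCommGroup E] [Module R E] [Small.{w} R]
    (ι : IsLocalRing.ResidueField R →ₗ[R] E)
    (hE : IsInjectiveHull R (IsLocalRing.ResidueField R) E ι)
    (A : Type v) [AddCommGroup A] [Module R A] [IsArtinian R A]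
    (hdim : ringKrullDim (R ⧸ Module.annihilator R A) ≤ 1) :
    rInvariant R A = cInvariant R (A →ₗ[R] E) := by
  have hb : Module.Baer R E := .of_injective hE.injective_module
  have key := minGenerators_eq_residualLength (A := A) hb ι hE.injective_map hE.essential
  refine le_antisymm (iSup_le fun B => ?_) (iSup_le fun L => ?_)
  -- Every `B` is the set of common zeros of its annihilator, so each term of `r(A)` is a term of
  -- `c(N)`.
  · rw [← Submodule.homCoannihilator_homAnnihilator hb ι hE.injective_map B, ← key]
    exact le_iSup (fun L : Submodule R (A →ₗ[R] E) => minGenerators L) _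
  · rw [key L]
    exact le_iSup (fun B : Submodule R A => residualLength R B) _
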